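/- **Setting.** A transitive chain $(V,\mathbf r)$ is a finite non-empty set $V$ with jump rates $\mathbf r=(r_{x,y})_{x,y\in V}$ such that $r_{x,y}=r_{y,x}\ge 0$, $r_{x,x}=0$, the continuous-time Markov chain on $V$ with generator $Q$ ($Q(x,y)=r_{x,y}$ for $x\ne y$, $Q(x,x)=-\sum_y r_{x,y}$) is irreducible, $\sum_y r_{x,y}=1$ for every $x$, and for all $u,v\in V$ there is a permutation $\phi$ of $V$ with $\phi(u)=v$ and $r_{\phi(x),\phi(y)}=r_{x,y}$ for all $x,y$. Let $t_{\mathrm{rel}}(\mathbf r)$ be its relaxation time, the inverse of the second smallest eigenvalue of $-Q$. For probability measures $\mu,\nu$ on $V$ let $\mathbb P_{\mu,\nu}$ be the joint law of two independent (right-continuous) chains $X,Y$ with rates $\mathbf r$, $X(0)\sim\mu$, $Y(0)\sim\nu$, and let $\tau_{\mathrm{meet}}=\inf\{t\ge 0: X(t)=Y(t)\}$. Put $$t_{\mathrm{meet}}(\mathbf r)=\mathbb E_{\pi,\pi}\,\tau_{\mathrm{meet}},\qquad \alpha_t(\mathbf r)=\frac1{|V|}\sum_{x\in V}\mathbb P_{\delta_x,\nu_x}(\tau_{\mathrm{meet}}>t),$$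 where $\pi$ is the uniform distribution on $V$, $\delta_x$ is the point mass at $x$ and $\nu_x(y)=r_{x,y}$. Let $P_t(\mathbf r)=\mathbb E|\xi_t|/|V|$, where $\xi_t$ is the set of occupied sites at time $t$ of coalescing random walks with rates $\mathbf r$ started with one particle at every site of $V$: each particle performs an independent chain with rates $\mathbf r$, and particles that meet merge. Write $A_n\ll B_n$ for $A_n/B_n\to 0$. **Proposition.** Let $(V_n,\mathbf r_n)_n$ be a sequence of transitive chains with $t_{\mathrm{rel}}(\mathbf r_n)\ll t_{\mathrm{meet}}(\mathbf r_n)$, and let $(t_n)_n$ be a sequence of times with $t_{\mathrm{rel}}(\mathbf r_n)\ll t_n\ll t_{\mathrm{meet}}(\mathbf r_n)$. (Each $t_{\mathrm{meet}}(\mathbf r_n)$ is finite.) Then $$\lim_{n\to\infty}\frac{2\,t_{\mathrm{meet}}(\mathbf r_n)\,\alpha_{t_n}(\mathbf r_n)}{|V_n|}=1 .$$ Consequently, for such a sequence, the two statements $$\lim_{n\to\infty} t_n\,\alpha_{t_n}(\mathbf r_n)\,P_{t_n}(\mathbf r_n)=1\qquad\text{and}\qquad \lim_{n\to\infty}\frac{|V_n|\,t_n}{2\,t_{\mathrm{meet}}(\mathbf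 r_n)}\,P_{t_n}(\mathbf r_n)=1$$ are equivalent. -/

import Mathlib

open Filter Topology MeasureTheory Asymptotics
open scoped ENNReal NNReal

noncomputable section

namespace CRW

section Chain

variable {V : Type*} [Fintype V] [DecidableEq V]

/-- The total jump rate `r(x) = ∑_y r_{x,y}` from the state `x`. -/
def totalRate (r : V → V → ℝ) (x : V) : ℝ := ∑ y, r x y

/-- The infinitesimal generator `Q` of the continuous-time Markov chain with jump rates `r`:
`Q(x,y) = r_{x,y}` for `x ≠ y` and `Q(x,x) = -r(x)`. -/
def generator (r : V → V → ℝ) : Matrix V V ℝ :=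
  Matrix.of fun x y => if x = y then -totalRate r x else r x y

/-- The transition kernel `p_t = exp(tQ)`. -/
def transition (r : V → V → ℝ) (t : ℝ) : Matrix V V ℝ :=
  NormedSpace.exp (t • generator r)

/-- `r` is a family of symmetric jump rates on the finite set `V` whose Markov chain is
irreducible, that is, `p_t(x,y) > 0` for all states `x, y` and all `t > 0`. -/
structure IsSymmIrredRates (r : V → V → ℝ) : Prop where
  nonneg : ∀ x y, 0 ≤ r x y
  diag : ∀ x, r x x = 0
  symm : ∀ x y, r x y = r y x
  irred : ∀ t : ℝ, 0 < t → ∀ x y, 0 < transition r t x y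

/-- A transitive chain, with the normalisation that every state has total jump rate `1`:
for all states `u, v` some permutation of the state space preserves the rates
and maps `u` to `v`. -/
structure IsTransitiveChain (r : V → V → ℝ) : Prop extends IsSymmIrredRates r where
  transitive : ∀ u v : V, ∃ φ : Equiv.Perm V, φ u = v ∧ ∀ x y, r (φ x) (φ y) = r x y
  totalRate_eq_one : ∀ x, totalRate r x = 1

/-- The spectral gap: the second smallest eigenvalue of `-Q`. For an irreducible symmetric chain
with at least two states the smallest eigenvalue of `-Q` is `0` and it is simple, so the
second smallest eigenvalue is the smallest positive one. -/
def spectralGap (r : V → V → ℝ) : ℝ :=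
  sInf {l : ℝ | 0 < l ∧ Module.End.HasEigenvalue (Matrix.toLin' (-generator r)) l}

/-- The relaxation time: the inverse of the spectral gap. -/
def relaxTime (r : V → V → ℝ) : ℝ := (spectralGap r)⁻¹

end Chain

section Walk

/-- The right-continuous paths `[0,∞) → V`, for the discrete topology on `V`. -/
def Path (V : Type*) : Type _ :=
  {w : ℝ≥0 → V // ∀ t : ℝ≥0, ∀ᶠ s in 𝓝[>] t, w s = w t}

/-- The position of a path at a time. -/
def Path.pos {V : Type*} (w : Path V) (t : ℝ≥0) : V := w.1 t

/-- The σ-algebra on paths generated by the positions at all times. -/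
instance Path.instMeasurableSpace (V : Type*) : MeasurableSpace (Path V) :=
  ⨆ t : ℝ≥0, MeasurableSpace.comap (fun w : Path V => w.pos t) ⊤

variable {V : Type*} [Fintype V] [DecidableEq V]

/-- `P` is the law `ℙ_x` of the walk with jump rates `r` started at `x`: the probability measure on
right-continuous paths with
`ℙ_x(X(t_0) = y_0, …, X(t_k) = y_k) = ∏_{i < k} p_{t_{i+1} - t_i}(y_i, y_{i+1})`
whenever `0 = t_0 ≤ t_1 ≤ … ≤ t_k` and `y_0 = x`. -/
structure IsWalkLaw (r : V → V → ℝ) (x : V) (P : Measure (Path V)) : Prop where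
  isProb : IsProbabilityMeasure P
  fdd : ∀ (k : ℕ) (t : ℕ → ℝ≥0) (y : ℕ → V), Monotone t → t 0 = 0 → y 0 = x →
    P {w | ∀ i ≤ k, w.pos (t i) = y i} =
      ENNReal.ofReal
        (∏ i ∈ Finset.range k, transition r ((t (i + 1) : ℝ) - (t i : ℝ)) (y i) (y (i + 1)))

/-- The law `ℙ_μ` of the walk whose starting position has distribution `μ`,
where `P x` is the law of the walk started at `x`. -/
def startLaw (P : V → Measure (Path V)) (μ : V → ℝ) : Measure (Path V) :=
  ∑ x, ENNReal.ofReal (μ x) • P x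

/-- The joint law `ℙ_{μ,ν}` of two independent walks with starting distributions `μ` and `ν`. -/
def pairLaw (P : V → Measure (Path V)) (μ ν : V → ℝ) : Measure (Path V × Path V) :=
  (startLaw P μ).prod (startLaw P ν)

/-- The meeting time `τ_meet = inf {t : X(t) = Y(t)}` of two paths, `∞` if they never meet. -/
def meetTime (w : Path V × Path V) : ℝ≥0∞ :=
  ⨅ (t : ℝ≥0) (_ : w.1.pos t = w.2.pos t), (t : ℝ≥0∞)

/-- The uniform distribution `π` on `V`. -/
def unif (V : Type*) [Fintype V] : V → ℝ := fun _ => 1 / (Fintype.card V : ℝ)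

/-- The point mass at `x`. -/
def pointMass (x : V) : V → ℝ := fun y => if y = x then 1 else 0

/-- The distribution `ν_x(y) = r_{x,y} / r(x)` of the first jump from `x`. -/
def jumpDist (r : V → V → ℝ) (x : V) : V → ℝ := fun y => r x y / totalRate r x

/-- The mean meeting time `t_meet = 𝔼_{π,π} τ_meet`. -/
def meanMeetTime (P : V → Measure (Path V)) : ℝ≥0∞ :=
  ∫⁻ w, meetTime w ∂(pairLaw P (unif V) (unif V))

/-- `α_t(x) = r(x) ℙ_{x,ν_x}(τ_meet > t)`. -/
def alphaAt (r : V → V → ℝ) (P : V → Measure (Path V)) (t : ℝ≥0) (x : V) : ℝ :=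
  totalRate r x * (pairLaw P (pointMass x) (jumpDist r x)).real {w | (t : ℝ≥0∞) < meetTime w}

/-- `α_t`, the average of `α_t(x)` over all states `x`. -/
def alpha (r : V → V → ℝ) (P : V → Measure (Path V)) (t : ℝ≥0) : ℝ :=
  (∑ x, alphaAt r P t x) / (Fintype.card V : ℝ)

end Walk

section Coalescing

variable {V : Type*} [Fintype V] [DecidableEq V]

/-- The jump rates of the set `ξ_t` of occupied sites in coalescing random walks: from `A`, for each
`x ∈ A` and each `y`, with rate `r_{x,y}` the particle at `x` moves to `y`, where it merges with
the particle at `y` if there is one. -/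
def coalRate (r : V → V → ℝ) (A B : Finset V) : ℝ :=
  ∑ x ∈ A, ∑ y, if insert y (A.erase x) = B then r x y else 0

/-- The density `P_t = 𝔼|ξ_t| / |V|` of coalescing random walks started with one particle
at every site, that is, from `ξ_0 = V`. -/
def density (r : V → V → ℝ) (t : ℝ≥0) : ℝ :=
  (∑ B : Finset V, transition (coalRate r) (t : ℝ) Finset.univ B * (B.card : ℝ)) /
    (Fintype.card V : ℝ)

end Coalescing

end CRW

end

/-!
The number `2 t_meet α_t / |V|` is the product of the mean of the meeting time `τ` of two
independent stationary walks and the density of `τ` at `t`, so the claim is that `τ` is close to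
exponential, with an error controlled by `t_rel / t_meet` (as in the Aldous-Brown inequalities for
hitting times of reversible chains).

Let `K` be the generator of the pair of walks killed on the diagonal, a symmetric matrix indexed by
`OffDiag V`. Right-continuity reduces `{τ > t}` to a decreasing sequence of events on dyadic grids,
whose probabilities are powers of the restricted transition matrix, so the product formula
`tendsto_pow_exp_of_hasDerivAt` gives `ℙ_{x,y}(τ > t) = (exp (t K) 1)(x,y)`
(`prod_real_lt_meetTime`). As `-K 1 = 2 r`, diagonalising `K` yields (`exists_spectral`)
`ℙ_{π,π}(τ > t) = ∑ c_i exp (-l_i t)` and `α_t = (|V| / 2) ∑ c_i l_i exp (-l_i t)`,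
where `c_i ≥ 0` and `∑ c_i = 1 - 1 / |V|`.

The pair of walks has the spectral gap `g = 1 / t_rel` of a single walk (`poincare_pair`). For a
normalised eigenfunction `v_i` of `-K`, extended by `0` to the diagonal, the variance is `1 - c_i`
and the Dirichlet form is `l_i`, hence `1 - c_i ≤ l_i / g`. The smallest rate is at most
`1 / t_meet`, so its weight is at least `1 - t_rel / t_meet`, and every other term of the
density is at most `c_i / t`. This gives the bounds of `mean_mul_density_bounds`,
`(1 - t_rel / t_meet)² (1 - t / t_meet) ≤ 2 t_meet α_t / |V| ≤ 1 + t_rel / t`,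
and both sides tend to `1`.
-/

namespace CRW

/-! ### Exponentials and powers in Banach algebras and of matrices -/

section Banach

variable {A : Type*} [NormedRing A] [NormOneClass A]

theorem norm_pow_sub_pow_le {a b : A} {c : ℝ} (hc : 1 ≤ c) (ha : ‖a‖ ≤ c) (hb : ‖b‖ ≤ c) (n : ℕ) :
    ‖a ^ n - b ^ n‖ ≤ n * ‖a - b‖ * c ^ n := by
  have hc0 : 0 ≤ c := by linarith
  induction n with
  | zero => simp
  | succ n ih =>
    have h1 : a ^ (n + 1) - b ^ (n + 1) = (a ^ n - b ^ n) * a + b ^ n * (a - b) := by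
      rw [pow_succ, pow_succ]; noncomm_ring
    rw [h1]
    have h2 : ‖(a ^ n - b ^ n) * a‖ ≤ (n * ‖a - b‖ * c ^ n) * c :=
      (norm_mul_le _ _).trans (mul_le_mul ih ha (norm_nonneg _) (by positivity))
    have h3 : ‖b ^ n * (a - b)‖ ≤ c ^ n * ‖a - b‖ :=
      (norm_mul_le _ _).trans (mul_le_mul_of_nonneg_right
        ((norm_pow_le b n).trans (pow_le_pow_left₀ (norm_nonneg _) hb n)) (norm_nonneg _))
    have h4 : c ^ n * ‖a - b‖ ≤ c ^ (n + 1) * ‖a - b‖ :=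
      mul_le_mul_of_nonneg_right (pow_le_pow_right₀ hc (Nat.le_succ n)) (norm_nonneg _)
    calc _ ≤ _ := norm_add_le _ _
      _ ≤ (n * ‖a - b‖ * c ^ n) * c + c ^ (n + 1) * ‖a - b‖ := add_le_add h2 (h3.trans h4)
      _ = _ := by push_cast; ring

variable [NormedAlgebra ℝ A]

theorem eventually_norm_le_exp_of_hasDerivAt {M : ℝ → A} {K : A} (hM : HasDerivAt M K 0)
    (h0 : M 0 = 1) : ∀ᶠ s in 𝓝 (0 : ℝ), ‖M s‖ ≤ Real.exp ((‖K‖ + 1) * |s|) := by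
  have h := (hasDerivAt_iff_isLittleO.1 hM).def (c := 1) one_pos
  filter_upwards [h] with s hs
  rw [h0, sub_zero, one_mul, Real.norm_eq_abs] at hs
  have h1 : M s = (M s - 1 - s • K) + 1 + s • K := by abel
  have h2 : ‖M s‖ ≤ |s| + 1 + |s| * ‖K‖ := by
    rw [h1]
    refine (norm_add₃_le).trans ?_
    rw [norm_one, norm_smul, Real.norm_eq_abs]
    gcongr
  have := Real.add_one_le_exp ((‖K‖ + 1) * |s|)
  linarith

/-- Powers of a curve through `1` with velocity `K`, sampled at `t / n`, converge to `exp (t K)`: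
the product formula behind the killed semigroup. -/
theorem tendsto_pow_exp_of_hasDerivAt [CompleteSpace A] {M : ℝ → A} {K : A}
    (hM : HasDerivAt M K 0) (h0 : M 0 = 1) (t : ℝ) :
    Tendsto (fun n : ℕ => M (t / n) ^ n) atTop (𝓝 (NormedSpace.exp (t • K))) := by
  let _ : NormedAlgebra ℚ A := NormedAlgebra.restrictScalars ℚ ℝ A
  set E : ℝ → A := fun s => NormedSpace.exp (s • K) with hE
  have hE0 : E 0 = 1 := by simp [hE, NormedSpace.exp_zero]
  have hEd : HasDerivAt E K 0 := by
    simpa [hE, NormedSpace.exp_zero] using hasDerivAt_exp_smul_const K (0 : ℝ)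
  have hlim : Tendsto (fun n : ℕ => t / (n : ℝ)) atTop (𝓝 0) :=
    tendsto_const_div_atTop_nhds_zero_nat t
  have hD : (fun n : ℕ => M (t / n) - E (t / n)) =o[atTop] (fun n : ℕ => t / (n : ℝ)) := by
    have h := hasDerivAt_iff_isLittleO.1 (hM.sub hEd)
    simp only [Pi.sub_apply, h0, hE0, sub_self, smul_zero, sub_zero] at h
    exact h.comp_tendsto hlim
  have hmain : Tendsto (fun n : ℕ => M (t / n) ^ n - E (t / n) ^ n) atTop (𝓝 0) := by
    rw [Metric.tendsto_nhds]
    intro ε hε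
    set C := Real.exp ((‖K‖ + 1) * |t|) with hC
    have hCpos : 0 < C := Real.exp_pos _
    have hδ : 0 < ε / (2 * C * (|t| + 1)) := by positivity
    filter_upwards [hD.def hδ, hlim.eventually (eventually_norm_le_exp_of_hasDerivAt hM h0),
      hlim.eventually (eventually_norm_le_exp_of_hasDerivAt hEd hE0), eventually_gt_atTop 0]
      with n h1 h2 h3 hn
    have hn' : (0 : ℝ) < n := by exact_mod_cast hn
    have hle := norm_pow_sub_pow_le (Real.one_le_exp (by positivity)) h2 h3 n
    have hpow : Real.exp ((‖K‖ + 1) * |t / n|) ^ n = C := by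
      rw [← Real.exp_nat_mul, hC, abs_div, Nat.abs_cast]
      congr 1
      field_simp
    rw [hpow] at hle
    rw [dist_zero_right]
    rw [Real.norm_eq_abs, abs_div, Nat.abs_cast] at h1
    calc _ ≤ _ := hle
      _ ≤ n * (ε / (2 * C * (|t| + 1)) * (|t| / n)) * C := by gcongr
      _ = ε / 2 * (|t| / (|t| + 1)) := by field_simp
      _ ≤ ε / 2 * 1 := by
        gcongr
        rw [div_le_one (by positivity)]
        linarith
      _ < ε := by linarith
  have hconst : ∀ᶠ n : ℕ in atTop, E (t / n) ^ n = NormedSpace.exp (t • K) := by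
    filter_upwards [eventually_gt_atTop 0] with n hn
    have hn' : (n : ℝ) ≠ 0 := by exact_mod_cast hn.ne'
    rw [hE]
    simp only
    rw [← NormedSpace.exp_nsmul, ← Nat.cast_smul_eq_nsmul ℝ, smul_smul, mul_div_cancel₀ _ hn']
  have h := hmain.add (tendsto_const_nhds (x := NormedSpace.exp (t • K)))
  rw [zero_add] at h
  refine h.congr' ?_
  filter_upwards [hconst] with n hn
  rw [hn]; abel

end Banach

section Mat

open Matrix

variable {ι : Type*} [Fintype ι] [DecidableEq ι]

section
attribute [local instance] Matrix.linftyOpNormedRing Matrix.linftyOpNormedAlgebra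

theorem exp_mulVec_of_eigen {A : Matrix ι ι ℝ} {v : ι → ℝ} {l : ℝ} (h : A *ᵥ v = l • v) :
    NormedSpace.exp A *ᵥ v = Real.exp l • v := by
  have hp : ∀ n : ℕ, A ^ n *ᵥ v = l ^ n • v := by
    intro n
    induction n with
    | zero => simp
    | succ n ih => rw [pow_succ, ← mulVec_mulVec, h, mulVec_smul, ih, smul_smul, pow_succ, mul_comm]
  have h1 := NormedSpace.exp_series_hasSum_exp' (𝕂 := ℝ) A
  let φ : Matrix ι ι ℝ →L[ℝ] (ι → ℝ) := LinearMap.toContinuousLinearMap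
    { toFun := fun B => B *ᵥ v
      map_add' := fun B C => add_mulVec B C v
      map_smul' := fun c B => smul_mulVec c B v }
  have h2 : HasSum (fun n : ℕ => φ (((n.factorial : ℝ)⁻¹) • A ^ n)) (NormedSpace.exp A *ᵥ v) :=
    φ.hasSum h1
  have h3 := (NormedSpace.exp_series_hasSum_exp' (𝕂 := ℝ) l).smul_const v
  rw [← Real.exp_eq_exp_ℝ] at h3
  refine h2.unique (h3.congr_fun ?_)
  intro n
  simp only [map_smul]
  rw [smul_assoc]
  congr 1
  exact hp n

theorem hasDerivAt_exp_smul_zero (A : Matrix ι ι ℝ) (i j : ι) :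
    HasDerivAt (fun s : ℝ => NormedSpace.exp (s • A) i j) (A i j) 0 := by
  have h := hasDerivAt_exp_smul_const A (0 : ℝ)
  simp only [zero_smul, NormedSpace.exp_zero, one_mul] at h
  exact hasDerivAt_pi.1 (hasDerivAt_pi.1 h i) j

/-- Matrix form of `tendsto_pow_exp_of_hasDerivAt`, with entrywise derivatives. -/
theorem tendsto_matrix_pow_exp [Nonempty ι] {M : ℝ → Matrix ι ι ℝ} {K : Matrix ι ι ℝ}
    (hM : ∀ i j, HasDerivAt (fun s => M s i j) (K i j) 0) (h0 : M 0 = 1) (t : ℝ) :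
    Tendsto (fun n : ℕ => M (t / n) ^ n) atTop (𝓝 (NormedSpace.exp (t • K))) := by
  have h : HasDerivAt M K 0 := hasDerivAt_pi.2 fun i => hasDerivAt_pi.2 fun j => hM i j
  exact tendsto_pow_exp_of_hasDerivAt h h0 t

end

/-- Orthonormal diagonalisation of a real symmetric matrix, the completeness of the eigenbasis being
recorded as Parseval's identity. -/
theorem exists_eigenbasis {A : Matrix ι ι ℝ} (hA : A.IsSymm) :
    ∃ (l : ι → ℝ) (v : ι → ι → ℝ), (∀ i, A *ᵥ v i = l i • v i) ∧ (∀ i, v i ⬝ᵥ v i = 1) ∧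
      ∀ f g : ι → ℝ, f ⬝ᵥ g = ∑ i, (f ⬝ᵥ v i) * (v i ⬝ᵥ g) := by
  have hH : A.IsHermitian := by
    rw [Matrix.IsHermitian, conjTranspose_eq_transpose_of_trivial]; exact hA
  refine ⟨hH.eigenvalues, fun i => (hH.eigenvectorBasis i).ofLp,
    fun i => hH.mulVec_eigenvectorBasis i, fun i => ?_, fun f g => ?_⟩
  · have := hH.eigenvectorBasis.inner_eq_one i
    rwa [EuclideanSpace.inner_eq_star_dotProduct, star_trivial] at this
  · have := hH.eigenvectorBasis.sum_inner_mul_inner (WithLp.toLp 2 f) (WithLp.toLp 2 g)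
    simp only [EuclideanSpace.inner_eq_star_dotProduct, star_trivial] at this
    rw [dotProduct_comm f g, ← this]
    refine Finset.sum_congr rfl fun i _ => ?_
    rw [dotProduct_comm f, dotProduct_comm g]

theorem dotProduct_exp_mulVec {A : Matrix ι ι ℝ} (hA : A.IsSymm) {l : ι → ℝ} {v : ι → ι → ℝ}
    (h1 : ∀ i, A *ᵥ v i = l i • v i)
    (h3 : ∀ f g : ι → ℝ, f ⬝ᵥ g = ∑ i, (f ⬝ᵥ v i) * (v i ⬝ᵥ g)) (t : ℝ) (f g : ι → ℝ) :
    f ⬝ᵥ (NormedSpace.exp (t • A) *ᵥ g) =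
      ∑ i, (f ⬝ᵥ v i) * (v i ⬝ᵥ g) * Real.exp (t * l i) := by
  have hs : (NormedSpace.exp (t • A)).IsSymm := (hA.smul t).exp
  rw [h3]
  refine Finset.sum_congr rfl fun i _ => ?_
  have h4 : NormedSpace.exp (t • A) *ᵥ v i = Real.exp (t * l i) • v i :=
    exp_mulVec_of_eigen (by rw [smul_mulVec, h1, smul_smul])
  have h5 : v i ⬝ᵥ (NormedSpace.exp (t • A) *ᵥ g) = Real.exp (t * l i) * (v i ⬝ᵥ g) := by
    rw [dotProduct_mulVec, ← mulVec_transpose, hs.eq, h4, smul_dotProduct, smul_eq_mul]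
  rw [h5]; ring

omit [DecidableEq ι] in
theorem dotProduct_mulVec_eigenbasis {A : Matrix ι ι ℝ} (hA : A.IsSymm) {l : ι → ℝ}
    {v : ι → ι → ℝ} (h1 : ∀ i, A *ᵥ v i = l i • v i)
    (h3 : ∀ f g : ι → ℝ, f ⬝ᵥ g = ∑ i, (f ⬝ᵥ v i) * (v i ⬝ᵥ g)) (f g : ι → ℝ) :
    f ⬝ᵥ (A *ᵥ g) = ∑ i, (f ⬝ᵥ v i) * (v i ⬝ᵥ g) * l i := by
  rw [h3]
  refine Finset.sum_congr rfl fun i _ => ?_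
  rw [dotProduct_mulVec, ← mulVec_transpose, hA.eq, h1, smul_dotProduct, smul_eq_mul]
  ring

end Mat

/-! ### The Poincaré inequality for a single walk -/

section Single

open Matrix

variable {V : Type*} [Fintype V] [DecidableEq V] {r : V → V → ℝ}

theorem generator_isSymm (hr : IsSymmIrredRates r) : (generator r).IsSymm := by
  ext x y
  by_cases h : x = y
  · subst h; rfl
  · simp [generator, h, Ne.symm h, hr.symm x y]

theorem generator_apply_of_ne {x y : V} (h : x ≠ y) : generator r x y = r x y := by
  simp [generator, h]

theorem generator_sum (hr : IsSymmIrredRates r) (x : V) : ∑ y, generator r x y = 0 := by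
  have h : ∀ y, generator r x y = r x y - if x = y then totalRate r x else 0 := by
    intro y
    by_cases h : x = y
    · subst h; simp [generator, hr.diag]
    · simp [generator, h]
  simp [h, Finset.sum_sub_distrib, totalRate]

theorem transition_isSymm (hr : IsSymmIrredRates r) (t : ℝ) : (transition r t).IsSymm :=
  ((generator_isSymm hr).smul t).exp

theorem transition_sum (hr : IsSymmIrredRates r) (t : ℝ) (x : V) :
    ∑ y, transition r t x y = 1 := by
  have h : (t • generator r) *ᵥ (fun _ => (1 : ℝ)) = (0 : ℝ) • (fun _ => (1 : ℝ)) := by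
    ext x
    simp [mulVec, dotProduct, ← Finset.mul_sum, generator_sum hr]
  have := congrFun (exp_mulVec_of_eigen h) x
  simpa [transition, mulVec, dotProduct] using this

theorem transition_zero : transition r 0 = 1 := by
  simp [transition, NormedSpace.exp_zero]

theorem transition_nonneg (hr : IsSymmIrredRates r) {t : ℝ} (ht : 0 ≤ t) (x y : V) :
    0 ≤ transition r t x y := by
  rcases ht.eq_or_lt with rfl | ht
  · rw [transition_zero, Matrix.one_apply]; split_ifs <;> norm_num
  · exact (hr.irred t ht x y).le

theorem sum_transition_mul_sq_sub (hr : IsSymmIrredRates r) (t : ℝ) (h : V → ℝ) :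
    ∑ x, ∑ y, transition r t x y * (h x - h y) ^ 2 =
      2 * (h ⬝ᵥ h - h ⬝ᵥ (transition r t *ᵥ h)) := by
  have e : ∀ x y, transition r t x y * (h x - h y) ^ 2 =
      h x ^ 2 * transition r t x y + h y ^ 2 * transition r t y x
        - 2 * (h x * (transition r t x y * h y)) := by
    intro x y
    have := (transition_isSymm hr t).apply x y
    rw [this]; ring
  simp_rw [e, Finset.sum_sub_distrib, Finset.sum_add_distrib]
  rw [Finset.sum_comm (f := fun x y => h y ^ 2 * transition r t y x)]
  simp_rw [← Finset.mul_sum, transition_sum hr, mul_one]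
  simp only [dotProduct, mulVec]
  simp_rw [← pow_two]
  ring

/-- The eigenvalues of `-Q` are nonnegative, and irreducibility forces the eigenvectors with
eigenvalue `0` to be constant. -/
theorem eigenvalue_nonneg_and_const (hr : IsSymmIrredRates r) {l : ℝ} {v : V → ℝ}
    (hv : (-generator r) *ᵥ v = l • v) (hvv : v ⬝ᵥ v = 1) :
    0 ≤ l ∧ (l = 0 → ∀ x y, v x = v y) := by
  have hp : transition r 1 *ᵥ v = Real.exp (-l) • v := by
    apply exp_mulVec_of_eigen
    rw [one_smul, neg_smul, ← hv, neg_mulVec, neg_neg]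
  have hs := sum_transition_mul_sq_sub hr 1 v
  rw [hp, dotProduct_smul, hvv, smul_eq_mul, mul_one] at hs
  have hnn : ∀ x y, 0 ≤ transition r 1 x y * (v x - v y) ^ 2 := fun x y =>
    mul_nonneg (transition_nonneg hr zero_le_one x y) (sq_nonneg _)
  constructor
  · have h1 : 0 ≤ 2 * (1 - Real.exp (-l)) := by
      rw [← hs]
      exact Finset.sum_nonneg fun x _ => Finset.sum_nonneg fun y _ => hnn x y
    have h2 : Real.exp (-l) ≤ 1 := by linarith
    rw [Real.exp_le_one_iff] at h2
    linarith
  · rintro rfl x y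
    simp only [neg_zero, Real.exp_zero, sub_self, mul_zero] at hs
    have h1 := (Finset.sum_eq_zero_iff_of_nonneg
      (fun x _ => Finset.sum_nonneg fun y _ => hnn x y)).1 hs x (Finset.mem_univ _)
    have h2 := (Finset.sum_eq_zero_iff_of_nonneg (fun y _ => hnn x y)).1 h1 y (Finset.mem_univ _)
    have h3 := (mul_eq_zero.1 h2).resolve_left (hr.irred 1 one_pos x y).ne'
    exact sub_eq_zero.1 (pow_eq_zero_iff two_ne_zero |>.1 h3)

theorem hasEigenvalue_of_mulVec {A : Matrix V V ℝ} {l : ℝ} {v : V → ℝ} (hv : A *ᵥ v = l • v)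
    (hvv : v ⬝ᵥ v = 1) : Module.End.HasEigenvalue (Matrix.toLin' A) l := by
  refine Module.End.hasEigenvalue_of_hasEigenvector (x := v) ⟨?_, ?_⟩
  · rw [Module.End.mem_eigenspace_iff, Matrix.toLin'_apply, hv]
  · rintro rfl
    simp at hvv

theorem spectralGap_pos [Nonempty V] (hr : IsTransitiveChain r) : 0 < spectralGap r := by
  have hs := hr.toIsSymmIrredRates
  obtain ⟨l, v, h1, h2, h3⟩ := exists_eigenbasis (generator_isSymm hs).neg
  have hfin : {l : ℝ | 0 < l ∧
      Module.End.HasEigenvalue (Matrix.toLin' (-generator r)) l}.Finite :=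
    (Module.End.finite_hasEigenvalue _).subset fun l hl => hl.2
  -- If no eigenvalue were positive, `Q` would vanish, but its diagonal entries are `-1`.
  refine (Set.Nonempty.csInf_mem ?_ hfin).1
  by_contra hne
  rw [Set.not_nonempty_iff_eq_empty, Set.eq_empty_iff_forall_notMem] at hne
  have hl : ∀ i, l i = 0 := by
    intro i
    by_contra h0
    exact hne (l i) ⟨lt_of_le_of_ne (eigenvalue_nonneg_and_const hs (h1 i) (h2 i)).1 (Ne.symm h0),
      hasEigenvalue_of_mulVec (h1 i) (h2 i)⟩
  obtain ⟨x⟩ := ‹Nonempty V›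
  have := dotProduct_mulVec_eigenbasis (generator_isSymm hs).neg h1 h3 (Pi.single x 1)
    (Pi.single x 1)
  simp [hl, generator, hr.totalRate_eq_one] at this

omit [DecidableEq V] in
theorem sum_sq_sub_mean [Nonempty V] (h : V → ℝ) :
    ∑ x, (h x - (∑ y, h y) / Fintype.card V) ^ 2 =
      ∑ x, h x ^ 2 - (∑ x, h x) ^ 2 / Fintype.card V := by
  have hn : (Fintype.card V : ℝ) ≠ 0 := by simp
  simp_rw [sub_sq, Finset.sum_add_distrib, Finset.sum_sub_distrib, ← Finset.sum_mul,
    ← Finset.mul_sum, Finset.sum_const, Finset.card_univ, nsmul_eq_mul]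
  field_simp
  ring

/-- The Poincaré inequality `gap · n Var(h) ≤ ⟨h, -Q h⟩`. -/
theorem poincare [Nonempty V] (hr : IsTransitiveChain r) (h : V → ℝ) :
    spectralGap r * (∑ x, h x ^ 2 - (∑ x, h x) ^ 2 / Fintype.card V) ≤
      -(h ⬝ᵥ (generator r *ᵥ h)) := by
  have hs := hr.toIsSymmIrredRates
  have hn : (Fintype.card V : ℝ) ≠ 0 := by simp
  obtain ⟨l, v, h1, h2, h3⟩ := exists_eigenbasis (generator_isSymm hs).neg
  set m := (∑ y, h y) / Fintype.card V with hm
  -- After centring, `h` is orthogonal to the eigenvectors with eigenvalue `0`.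
  set k : V → ℝ := fun x => h x - m with hk
  have hk0 : ∑ x, k x = 0 := by
    simp only [hk, Finset.sum_sub_distrib, Finset.sum_const, Finset.card_univ, nsmul_eq_mul, hm]
    field_simp
    ring
  have hQk : generator r *ᵥ k = generator r *ᵥ h := by
    ext x
    simp [mulVec, dotProduct, hk, mul_sub, Finset.sum_sub_distrib, ← Finset.sum_mul,
      generator_sum hs]
  have hQ1 : (fun _ => m) ⬝ᵥ (generator r *ᵥ h) = 0 := by
    rw [dotProduct_mulVec, ← mulVec_transpose, (generator_isSymm hs).eq]
    have : generator r *ᵥ (fun _ => m) = 0 := by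
      ext x
      simp [mulVec, dotProduct, ← Finset.sum_mul, generator_sum hs]
    rw [this, zero_dotProduct]
  have hkk : -(h ⬝ᵥ (generator r *ᵥ h)) = k ⬝ᵥ ((-generator r) *ᵥ k) := by
    have : k = h - fun _ => m := rfl
    rw [neg_mulVec, dotProduct_neg, hQk, this, sub_dotProduct, hQ1, sub_zero]
  rw [hkk, ← sum_sq_sub_mean h, dotProduct_mulVec_eigenbasis (generator_isSymm hs).neg h1 h3]
  have hsq : ∑ x, (h x - (∑ y, h y) / Fintype.card V) ^ 2 = k ⬝ᵥ k := by
    simp only [dotProduct, hk, hm, pow_two]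
  rw [hsq, h3, Finset.mul_sum]
  refine Finset.sum_le_sum fun i _ => ?_
  obtain ⟨hl0, hlc⟩ := eigenvalue_nonneg_and_const hs (h1 i) (h2 i)
  rcases hl0.eq_or_lt with h0 | hpos
  · have : k ⬝ᵥ v i = 0 := by
      obtain ⟨x⟩ := ‹Nonempty V›
      have : ∀ y, v i y = v i x := fun y => hlc h0.symm y x
      simp only [dotProduct, this, ← Finset.sum_mul, hk0, zero_mul]
    simp [this]
  · have hg : spectralGap r ≤ l i :=
      csInf_le ⟨0, fun l hl => hl.1.le⟩ ⟨hpos, hasEigenvalue_of_mulVec (h1 i) (h2 i)⟩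
    rw [dotProduct_comm (v i) k, mul_comm]
    exact mul_le_mul_of_nonneg_left hg (mul_self_nonneg _)

end Single

/-! ### Two independent walks killed when they meet -/

section Pair

open Matrix
open scoped Kronecker

variable {V : Type*} [Fintype V] [DecidableEq V] {r : V → V → ℝ}

/-- The off-diagonal pairs, that is, the states of two walks that have not met. -/
abbrev OffDiag (V : Type*) : Type _ := {z : V × V // z.1 ≠ z.2}

/-- The generator `Q ⊗ 1 + 1 ⊗ Q` of two independent walks. -/
def pairGen (r : V → V → ℝ) : Matrix (V × V) (V × V) ℝ :=
  generator r ⊗ₖ 1 + 1 ⊗ₖ generator r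

/-- The generator of two independent walks killed when they meet: the restriction of `pairGen`
to the off-diagonal pairs. -/
def killedGen (r : V → V → ℝ) : Matrix (OffDiag V) (OffDiag V) ℝ :=
  (pairGen r).submatrix Subtype.val Subtype.val

theorem pairGen_apply (z w : V × V) : pairGen r z w =
    generator r z.1 w.1 * (if z.2 = w.2 then 1 else 0) +
      (if z.1 = w.1 then 1 else 0) * generator r z.2 w.2 := by
  simp [pairGen, Matrix.one_apply, kroneckerMap_apply]

theorem killedGen_isSymm (hr : IsSymmIrredRates r) : (killedGen r).IsSymm := by
  have h := generator_isSymm hr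
  ext z w
  simp only [killedGen, transpose_apply, submatrix_apply, pairGen_apply, h.apply z.1.1 w.1.1,
    h.apply z.1.2 w.1.2, eq_comm (a := w.1.2), eq_comm (a := w.1.1)]

theorem dotProduct_pairGen (f : V × V → ℝ) :
    f ⬝ᵥ (pairGen r *ᵥ f) =
      ∑ y, (fun x => f (x, y)) ⬝ᵥ (generator r *ᵥ fun x => f (x, y)) +
      ∑ x, (fun y => f (x, y)) ⬝ᵥ (generator r *ᵥ fun y => f (x, y)) := by
  simp only [dotProduct, mulVec, pairGen_apply, add_mul, Finset.sum_add_distrib, mul_add,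
    Fintype.sum_prod_type, mul_ite, ite_mul, mul_one, mul_zero, zero_mul, one_mul]
  congr 1
  · rw [Finset.sum_comm]
    simp
  · refine Finset.sum_congr rfl fun x _ => Finset.sum_congr rfl fun y _ => ?_
    rw [Finset.sum_comm]
    simp

omit [DecidableEq V] in
/-- Tensorisation of the variance of a function of two variables, in unnormalised form. -/
theorem sum_sq_prod_ge [Nonempty V] (f : V × V → ℝ) :
    (∑ y, (∑ x, f (x, y)) ^ 2) / Fintype.card V + (∑ x, (∑ y, f (x, y)) ^ 2) / Fintype.card V ≤
      ∑ z, f z ^ 2 + (∑ z, f z) ^ 2 / (Fintype.card V : ℝ) ^ 2 := by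
  have hn : (0 : ℝ) < Fintype.card V := by exact_mod_cast Fintype.card_pos
  set n : ℝ := (Fintype.card V : ℝ) with hnd
  let b : V → ℝ := fun x => ∑ y, f (x, y)
  let a : V → ℝ := fun y => ∑ x, f (x, y)
  have hab : ∑ x, b x = ∑ y, a y := Finset.sum_comm
  have hs : ∑ z, f z = ∑ y, a y := by rw [Fintype.sum_prod_type]; exact hab
  have h1 : ∑ y, ∑ x, (f (x, y) - b x / n) ^ 2 = ∑ z, f z ^ 2 - (∑ x, b x ^ 2) / n := by
    rw [Finset.sum_comm, Fintype.sum_prod_type, Finset.sum_div, ← Finset.sum_sub_distrib]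
    exact Finset.sum_congr rfl fun x _ => sum_sq_sub_mean fun y => f (x, y)
  have h2 : ∑ y, (∑ x, (f (x, y) - b x / n)) ^ 2 = ∑ y, a y ^ 2 - (∑ y, a y) ^ 2 / n := by
    rw [← sum_sq_sub_mean a]
    refine Finset.sum_congr rfl fun y _ => ?_
    rw [Finset.sum_sub_distrib, ← Finset.sum_div, hab]
  have h3 : ∑ y, (∑ x, (f (x, y) - b x / n)) ^ 2 ≤ n * ∑ y, ∑ x, (f (x, y) - b x / n) ^ 2 := by
    rw [Finset.mul_sum]
    refine Finset.sum_le_sum fun y _ => ?_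
    simpa [hnd] using sq_sum_le_card_mul_sum_sq (s := Finset.univ)
      (f := fun x => f (x, y) - b x / n)
  rw [h1, h2] at h3
  rw [hs]
  change (∑ y, a y ^ 2) / n + (∑ x, b x ^ 2) / n ≤ _
  have h4 : (∑ y, a y ^ 2 - (∑ y, a y) ^ 2 / n) / n ≤ ∑ z, f z ^ 2 - (∑ x, b x ^ 2) / n := by
    rwa [div_le_iff₀ hn, mul_comm]
  have h5 : (∑ y, a y ^ 2 - (∑ y, a y) ^ 2 / n) / n =
      (∑ y, a y ^ 2) / n - (∑ y, a y) ^ 2 / n ^ 2 := by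
    field_simp
  linarith

/-- The pair of walks satisfies the Poincaré inequality with the constant of a single walk. -/
theorem poincare_pair [Nonempty V] (hr : IsTransitiveChain r) (f : V × V → ℝ) :
    spectralGap r * (∑ z, f z ^ 2 - (∑ z, f z) ^ 2 / (Fintype.card V : ℝ) ^ 2) ≤
      -(f ⬝ᵥ (pairGen r *ᵥ f)) := by
  rw [dotProduct_pairGen, neg_add, ← Finset.sum_neg_distrib, ← Finset.sum_neg_distrib]
  have h1 := Finset.sum_le_sum fun y (_ : y ∈ Finset.univ) => poincare hr fun x => f (x, y)
  have h2 := Finset.sum_le_sum fun x (_ : x ∈ Finset.univ) => poincare hr fun y => f (x, y)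
  rw [← Finset.mul_sum, Finset.sum_sub_distrib, ← Finset.sum_div] at h1 h2
  refine le_trans ?_ (add_le_add h1 h2)
  rw [← mul_add]
  refine mul_le_mul_of_nonneg_left ?_ (spectralGap_pos hr).le
  have h3 := sum_sq_prod_ge f
  have h4 : ∑ y, ∑ x, f (x, y) ^ 2 = ∑ z, f z ^ 2 := by
    rw [Fintype.sum_prod_type, Finset.sum_comm]
  have h5 : ∑ x, ∑ y, f (x, y) ^ 2 = ∑ z, f z ^ 2 := by rw [Fintype.sum_prod_type]
  linarith

theorem sum_offDiag (G : V × V → ℝ) :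
    ∑ w : OffDiag V, G w.1 + ∑ a, G (a, a) = ∑ z, G z := by
  rw [← Fintype.sum_subtype_add_sum_subtype (fun z : V × V => z.1 ≠ z.2) G]
  congr 1
  refine Fintype.sum_equiv ⟨fun a => ⟨(a, a), by simp⟩, fun z => z.1.1, fun a => rfl, ?_⟩ _ _
    fun a => rfl
  rintro ⟨⟨a, b⟩, h⟩
  simp only [ne_eq, not_not] at h
  subst h
  rfl

theorem sum_offDiag_of_diag_eq_zero (G : V × V → ℝ) (hG : ∀ a, G (a, a) = 0) :
    ∑ z, G z = ∑ w : OffDiag V, G w.1 := by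
  rw [← sum_offDiag G]; simp [hG]

/-- The Poincaré inequality for functions vanishing on the diagonal. -/
theorem poincare_killed [Nonempty V] (hr : IsTransitiveChain r) (f : OffDiag V → ℝ) :
    spectralGap r * (f ⬝ᵥ f - (f ⬝ᵥ 1) ^ 2 / (Fintype.card V : ℝ) ^ 2) ≤
      -(f ⬝ᵥ (killedGen r *ᵥ f)) := by
  let F : V × V → ℝ := fun z => if h : z.1 ≠ z.2 then f ⟨z, h⟩ else 0
  have hF : ∀ w : OffDiag V, F w.1 = f w := fun w => by simp [F, w.2]
  have hF0 : ∀ a, F (a, a) = 0 := fun a => by simp [F]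
  have h := poincare_pair hr F
  have e1 : ∑ z, F z ^ 2 = f ⬝ᵥ f := by
    rw [sum_offDiag_of_diag_eq_zero _ (by simp [hF0])]
    simp [hF, dotProduct, pow_two]
  have e2 : ∑ z, F z = f ⬝ᵥ 1 := by
    rw [sum_offDiag_of_diag_eq_zero _ hF0]
    simp [hF, dotProduct]
  have e3 : F ⬝ᵥ (pairGen r *ᵥ F) = f ⬝ᵥ (killedGen r *ᵥ f) := by
    simp only [dotProduct, mulVec]
    rw [sum_offDiag_of_diag_eq_zero _ (by simp [hF0])]
    refine Finset.sum_congr rfl fun w _ => ?_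
    rw [sum_offDiag_of_diag_eq_zero _ (by simp [hF0]), hF]
    simp [hF, killedGen]
  rwa [e1, e2, e3] at h

/-- The killing rate at `(x, y)` is `2 r_{x,y}`. -/
theorem killedGen_mulVec_one (hr : IsSymmIrredRates r) (w : OffDiag V) :
    (killedGen r *ᵥ 1) w = -2 * r w.1.1 w.1.2 := by
  obtain ⟨⟨x, y⟩, hxy⟩ := w
  have hxy' : x ≠ y := hxy
  have h := sum_offDiag fun z => pairGen r (x, y) z
  have h0 : ∑ z, pairGen r (x, y) z = 0 := by
    simp only [pairGen_apply, Finset.sum_add_distrib, Fintype.sum_prod_type]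
    simp [generator_sum hr]
  have h1 : ∑ a, pairGen r (x, y) (a, a) = 2 * r x y := by
    simp [pairGen_apply, Finset.sum_add_distrib, generator_apply_of_ne hxy',
      generator_apply_of_ne hxy'.symm, hr.symm y x]
    ring
  have h2 : (killedGen r *ᵥ 1) ⟨(x, y), hxy⟩ = ∑ w : OffDiag V, pairGen r (x, y) w.1 := by
    simp [mulVec, dotProduct, killedGen]
  rw [h2]
  simp only
  linarith

theorem card_offDiag : (Fintype.card (OffDiag V) : ℝ) =
    (Fintype.card V : ℝ) ^ 2 - Fintype.card V := by
  have h := sum_offDiag (V := V) fun _ => 1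
  rw [Finset.sum_const, Finset.sum_const, Finset.sum_const, Finset.card_univ, Finset.card_univ,
    Finset.card_univ, Fintype.card_prod] at h
  simp only [nsmul_eq_mul, mul_one, Nat.cast_mul] at h
  linarith

/-- A one-point chain is excluded by the total jump rate `1` and `r_{x,x} = 0`. -/
theorem one_lt_card [Nonempty V] (hr : IsTransitiveChain r) : 1 < Fintype.card V := by
  by_contra h
  have hsub : Subsingleton V := Fintype.card_le_one_iff_subsingleton.1 (not_lt.1 h)
  obtain ⟨x⟩ := ‹Nonempty V›
  have h1 := hr.totalRate_eq_one x
  have h2 : totalRate r x = 0 :=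
    Finset.sum_eq_zero fun y _ => by rw [Subsingleton.elim y x, hr.diag]
  linarith

/-- The survival probability `u_t(w)` of two walks started at the off-diagonal pair `w`, in terms of
the killed semigroup. -/
noncomputable def survival (r : V → V → ℝ) (t : ℝ) : OffDiag V → ℝ :=
  NormedSpace.exp (t • killedGen r) *ᵥ 1

/-- Spectral representation of the meeting time of two stationary walks: its law is a mixture of
exponential laws with rates `l i` and weights `c i`, plus an atom at `0` of mass `1 / |V|`.
The bound on `1 - c i` is the Poincaré inequality applied to the `i`-th killed eigenfunction. -/
theorem exists_spectral [Nonempty V] (hr : IsTransitiveChain r) :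
    ∃ c l : OffDiag V → ℝ, (∀ i, 0 ≤ c i) ∧ (∀ i, 0 < l i) ∧
      (∑ i, c i = 1 - 1 / Fintype.card V) ∧ (∀ i, spectralGap r * (1 - c i) ≤ l i) ∧
      (∀ t, (∑ w, survival r t w) / (Fintype.card V : ℝ) ^ 2 = ∑ i, c i * Real.exp (-(l i * t))) ∧
      ∀ t, (∑ w : OffDiag V, r w.1.1 w.1.2 * survival r t w) / (Fintype.card V : ℝ) =
        Fintype.card V / 2 * ∑ i, c i * l i * Real.exp (-(l i * t)) := by
  have hs := hr.toIsSymmIrredRates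
  have hK := killedGen_isSymm hs
  have hn : (0 : ℝ) < Fintype.card V := by exact_mod_cast Fintype.card_pos
  have hg := spectralGap_pos hr
  obtain ⟨l, v, h1, h2, h3⟩ := exists_eigenbasis hK
  set n : ℝ := (Fintype.card V : ℝ) with hnd
  have hsum : ∑ i, (v i ⬝ᵥ 1) ^ 2 / n ^ 2 = 1 - 1 / n := by
    have h4 := h3 1 1
    have h5 : (1 : OffDiag V → ℝ) ⬝ᵥ 1 = n ^ 2 - n := by
      rw [← card_offDiag]; simp [dotProduct]
    rw [h5] at h4
    rw [← Finset.sum_div]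
    have h6 : ∑ i, (v i ⬝ᵥ 1) ^ 2 = n ^ 2 - n := by
      rw [h4]
      refine Finset.sum_congr rfl fun i _ => ?_
      rw [dotProduct_comm 1 (v i), pow_two]
    rw [h6]
    field_simp
  have hc0 : ∀ i, 0 ≤ (v i ⬝ᵥ 1) ^ 2 / n ^ 2 := fun i => by positivity
  have hgap : ∀ i, spectralGap r * (1 - (v i ⬝ᵥ 1) ^ 2 / n ^ 2) ≤ -l i := by
    intro i
    have h := poincare_killed hr (v i)
    rwa [h1, dotProduct_smul, h2, smul_eq_mul, mul_one] at h
  refine ⟨fun i => (v i ⬝ᵥ 1) ^ 2 / n ^ 2, fun i => -l i, hc0, fun i => ?_, hsum, hgap,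
    fun t => ?_, fun t => ?_⟩
  -- The atom at `0` leaves total weight less than `1`, so the gap bound makes every rate positive.
  · refine lt_of_lt_of_le (mul_pos hg ?_) (hgap i)
    have h4 := Finset.single_le_sum (fun i _ => hc0 i) (Finset.mem_univ i)
    rw [hsum] at h4
    have : 0 < 1 / n := by positivity
    linarith
  · have h4 := dotProduct_exp_mulVec hK h1 h3 t 1 1
    have h5 : ∑ w, survival r t w =
        (1 : OffDiag V → ℝ) ⬝ᵥ (NormedSpace.exp (t • killedGen r) *ᵥ 1) := by
      simp [dotProduct, survival]
    rw [h5, h4, Finset.sum_div]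
    refine Finset.sum_congr rfl fun i _ => ?_
    rw [dotProduct_comm 1 (v i)]
    ring_nf
  · have h4 := dotProduct_exp_mulVec hK h1 h3 t (killedGen r *ᵥ 1) 1
    have h5 : ∑ w : OffDiag V, r w.1.1 w.1.2 * survival r t w =
        -(1 / 2) * ((killedGen r *ᵥ 1) ⬝ᵥ (NormedSpace.exp (t • killedGen r) *ᵥ 1)) := by
      simp only [dotProduct, Finset.mul_sum]
      refine Finset.sum_congr rfl fun w _ => ?_
      rw [killedGen_mulVec_one hs]
      simp only [survival]
      ring
    have h6 : ∀ i, (killedGen r *ᵥ 1) ⬝ᵥ v i = l i * (v i ⬝ᵥ 1) := by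
      intro i
      rw [dotProduct_comm, dotProduct_mulVec, ← mulVec_transpose, hK.eq, h1, smul_dotProduct,
        smul_eq_mul]
    rw [h5, h4, Finset.mul_sum, Finset.mul_sum, Finset.sum_div]
    refine Finset.sum_congr rfl fun i _ => ?_
    rw [h6]
    have : t * l i = -(-l i * t) := by ring
    rw [this]
    field_simp

end Pair

/-! ### Markov chains observed at discrete times -/

section Markov

open Matrix

variable {Ω S : Type*} [MeasurableSpace Ω] {μ : Measure Ω}
  [IsFiniteMeasure μ] {Z : ℕ → Ω → S} {M : Matrix S S ℝ} {z₀ : S} {D : S → Prop}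
  [Fintype {x // D x}] [DecidableEq {x // D x}]

/-- If the finite-dimensional distributions of `Z` from `z₀` are those of a chain with transition
matrix `M`, then the probability of remaining in `D` for `j` further steps is given by the powers of
the restriction of `M` to `D`. -/
theorem measureReal_stay_aux (hZ : ∀ i z, MeasurableSet {ω | Z i ω = z})
    (hD : ∀ i, MeasurableSet {ω | D (Z i ω)})
    (hfdd : ∀ (k : ℕ) (z : ℕ → S), z 0 = z₀ →
      μ.real {ω | ∀ i ≤ k, Z i ω = z i} = ∏ i ∈ Finset.range k, M (z i) (z (i + 1)))
    (j : ℕ) : ∀ (m : ℕ) (z : ℕ → S), z 0 = z₀ → ∀ hm : D (z m),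
      μ.real {ω | (∀ i ≤ m, Z i ω = z i) ∧ ∀ i, m ≤ i → i ≤ m + j → D (Z i ω)} =
        (∏ i ∈ Finset.range m, M (z i) (z (i + 1))) *
          ((M.submatrix Subtype.val Subtype.val : Matrix {x // D x} {x // D x} ℝ) ^ j *ᵥ 1)
            ⟨z m, hm⟩ := by
  classical
  induction j with
  | zero =>
    intro m z hz hm
    rw [pow_zero, one_mulVec, Pi.one_apply, mul_one, ← hfdd m z hz]
    congr 1
    ext ω
    simp only [Set.mem_ofPred_eq, add_zero, and_iff_left_iff_imp]
    intro h i h1 h2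
    obtain rfl : i = m := le_antisymm h2 h1
    rw [h i le_rfl]; exact hm
  | succ j ih =>
    intro m z hz hm
    set A : {x // D x} → Set Ω := fun w =>
      {ω | (∀ i ≤ m + 1, Z i ω = Function.update z (m + 1) w.1 i) ∧
        ∀ i, m + 1 ≤ i → i ≤ m + 1 + j → D (Z i ω)} with hA
    have hupd : ∀ (w : S) i, i ≤ m → Function.update z (m + 1) w i = z i := fun w i hi =>
      Function.update_of_ne (by omega) _ _
    have hset : {ω | (∀ i ≤ m, Z i ω = z i) ∧ ∀ i, m ≤ i → i ≤ m + (j + 1) → D (Z i ω)} =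
        ⋃ w ∈ (Finset.univ : Finset {x // D x}), A w := by
      ext ω
      simp only [Set.mem_ofPred_eq, hA, Finset.mem_univ, Set.iUnion_true, Set.mem_iUnion]
      constructor
      · rintro ⟨h1, h2⟩
        refine ⟨⟨Z (m + 1) ω, h2 _ (by omega) (by omega)⟩, fun i hi => ?_,
          fun i hi hi' => h2 i (by omega) (by omega)⟩
        rcases Nat.lt_or_ge m i with h | h
        · obtain rfl : i = m + 1 := by omega
          simp
        · rw [hupd _ i h, h1 i h]
      · rintro ⟨w, h1, h2⟩
        have h3 : ∀ i ≤ m, Z i ω = z i := fun i hi => by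
          rw [h1 i (by omega), hupd _ i hi]
        refine ⟨h3, fun i hi hi' => ?_⟩
        rcases Nat.lt_or_ge m i with h | h
        · exact h2 i h (by omega)
        · obtain rfl : i = m := by omega
          rw [h3 i le_rfl]; exact hm
    have hdisj : Set.PairwiseDisjoint (↑(Finset.univ : Finset {x // D x})) A := by
      intro w _ w' _ hww
      refine Set.disjoint_left.2 fun ω h1 h2 => hww ?_
      have e1 := h1.1 (m + 1) le_rfl
      have e2 := h2.1 (m + 1) le_rfl
      simp only [Function.update_self] at e1 e2
      exact Subtype.ext (e1.symm.trans e2)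
    have hmeas : ∀ w ∈ (Finset.univ : Finset {x // D x}), MeasurableSet (A w) := by
      intro w _
      simp only [hA, Set.ofPred_and, Set.ofPred_forall]
      refine MeasurableSet.inter ?_ ?_
      · exact MeasurableSet.iInter fun i => MeasurableSet.iInter fun _ => hZ i _
      · exact MeasurableSet.iInter fun i => MeasurableSet.iInter fun _ =>
          MeasurableSet.iInter fun _ => hD i
    rw [hset, measureReal_biUnion_finset hdisj hmeas, pow_succ', ← mulVec_mulVec]
    conv_rhs => rw [mulVec, dotProduct, Finset.mul_sum]
    refine Finset.sum_congr rfl fun w _ => ?_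
    have hw : D (Function.update z (m + 1) w.1 (m + 1)) := by simp [w.2]
    have h0 : Function.update z (m + 1) w.1 0 = z₀ := by rw [hupd _ 0 (Nat.zero_le _), hz]
    have h := ih (m + 1) (Function.update z (m + 1) w.1) h0 hw
    rw [h, Finset.prod_range_succ]
    have hp : ∏ i ∈ Finset.range m, M (Function.update z (m + 1) w.1 i)
        (Function.update z (m + 1) w.1 (i + 1)) = ∏ i ∈ Finset.range m, M (z i) (z (i + 1)) := by
      refine Finset.prod_congr rfl fun i hi => ?_
      rw [Finset.mem_range] at hi
      rw [hupd _ i (by omega), hupd _ (i + 1) (by omega)]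
    have hw' : (⟨Function.update z (m + 1) w.1 (m + 1), hw⟩ : {x // D x}) = w :=
      Subtype.ext (by simp)
    rw [hp, hw', hupd _ m le_rfl, Function.update_self, submatrix_apply, mul_assoc]

theorem measureReal_stay (hZ : ∀ i z, MeasurableSet {ω | Z i ω = z})
    (hD : ∀ i, MeasurableSet {ω | D (Z i ω)})
    (hfdd : ∀ (k : ℕ) (z : ℕ → S), z 0 = z₀ →
      μ.real {ω | ∀ i ≤ k, Z i ω = z i} = ∏ i ∈ Finset.range k, M (z i) (z (i + 1)))
    (hae : ∀ᵐ ω ∂μ, Z 0 ω = z₀) (hz₀ : D z₀) (j : ℕ) :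
    μ.real {ω | ∀ i ≤ j, D (Z i ω)} =
      ((M.submatrix Subtype.val Subtype.val : Matrix {x // D x} {x // D x} ℝ) ^ j *ᵥ 1)
        ⟨z₀, hz₀⟩ := by
  have h := measureReal_stay_aux hZ hD hfdd j 0 (fun _ => z₀) rfl hz₀
  rw [Finset.prod_range_zero, one_mul] at h
  rw [← h]
  refine measureReal_congr ?_
  filter_upwards [hae] with ω hω
  refine propext ⟨fun h => ⟨fun i hi => ?_, fun i _ hi => h i (by omega)⟩,
    fun h i hi => h.2 i (Nat.zero_le _) (by omega)⟩
  obtain rfl : i = 0 := by omega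
  exact hω

end Markov

/-! ### The meeting time of two walks -/

section Meeting

open Matrix
open scoped Kronecker

variable {V : Type*}

theorem measurableSet_pos_eq (t : ℝ≥0) (y : V) : MeasurableSet {w : Path V | w.pos t = y} :=
  le_iSup (fun t : ℝ≥0 => MeasurableSpace.comap (fun w : Path V => w.pos t) ⊤) t _
    ⟨{y}, trivial, rfl⟩

/-- The positions of two walks at a given time. -/
def pairPos (w : Path V × Path V) (s : ℝ≥0) : V × V := (w.1.pos s, w.2.pos s)

theorem setOf_pairPos_eq (s : ℝ≥0) (z : V × V) : {w : Path V × Path V | pairPos w s = z} =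
    {w | w.pos s = z.1} ×ˢ {w | w.pos s = z.2} := by
  ext w; simp [pairPos, Prod.ext_iff]

theorem measurableSet_pairPos_eq (s : ℝ≥0) (z : V × V) :
    MeasurableSet {w : Path V × Path V | pairPos w s = z} := by
  rw [setOf_pairPos_eq]
  exact (measurableSet_pos_eq s z.1).prod (measurableSet_pos_eq s z.2)

theorem measurableSet_pairPos_mem [Finite V] (s : ℝ≥0) (p : V × V → Prop) :
    MeasurableSet {w : Path V × Path V | p (pairPos w s)} := by
  have : {w : Path V × Path V | p (pairPos w s)} =
      ⋃ z ∈ {z | p z}, {w | pairPos w s = z} := by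
    ext w; simp
  rw [this]
  exact (Set.toFinite _).measurableSet_biUnion fun z _ => measurableSet_pairPos_eq s z

theorem exists_pos_eq_Ico (w : Path V) (s : ℝ≥0) :
    ∃ u, s < u ∧ ∀ v, s ≤ v → v < u → w.pos v = w.pos s := by
  obtain ⟨u, hu, h⟩ := (mem_nhdsGT_iff_exists_Ioo_subset).1 (w.2 s)
  refine ⟨u, hu, fun v h1 h2 => ?_⟩
  rcases h1.eq_or_lt with rfl | h1
  · rfl
  · exact h ⟨h1, h2⟩

/-- By right-continuity, the infimum defining the meeting time is attained. -/
theorem lt_meetTime_iff (w : Path V × Path V) (t : ℝ≥0) :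
    (t : ℝ≥0∞) < meetTime w ↔ ∀ s ≤ t, w.1.pos s ≠ w.2.pos s := by
  constructor
  · intro h s hs he
    have : meetTime w ≤ s := iInf₂_le s he
    exact absurd (h.trans_le this) (not_lt.2 (by exact_mod_cast hs))
  · intro h
    obtain ⟨u₁, h1, h1'⟩ := exists_pos_eq_Ico w.1 t
    obtain ⟨u₂, h2, h2'⟩ := exists_pos_eq_Ico w.2 t
    have hlt : t < min u₁ u₂ := lt_min h1 h2
    refine lt_of_lt_of_le (b := ((min u₁ u₂ : ℝ≥0) : ℝ≥0∞)) (by exact_mod_cast hlt) ?_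
    refine le_iInf₂ fun s hs => ?_
    rw [ENNReal.coe_le_coe]
    by_contra hcon
    rw [not_le] at hcon
    rcases le_total s t with hst | hst
    · exact h s hst hs
    · rw [h1' s hst (hcon.trans_le (min_le_left _ _)),
        h2' s hst (hcon.trans_le (min_le_right _ _))] at hs
      exact h t le_rfl hs

/-- Two right-continuous paths that do not meet at the dyadic subdivisions of `[0, t]` do not meet
in `[0, t]`. -/
theorem lt_meetTime_iff_dyadic (w : Path V × Path V) (t : ℝ≥0) :
    (t : ℝ≥0∞) < meetTime w ↔
      ∀ m i : ℕ, i ≤ 2 ^ m → w.1.pos (i * (t / 2 ^ m)) ≠ w.2.pos (i * (t / 2 ^ m)) := by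
  rw [lt_meetTime_iff]
  constructor
  · intro h m i hi
    apply h
    rw [mul_div_assoc', div_le_iff₀ (by positivity), mul_comm]
    gcongr
    exact_mod_cast hi
  · intro h s hs he
    obtain ⟨u₁, h1, h1'⟩ := exists_pos_eq_Ico w.1 s
    obtain ⟨u₂, h2, h2'⟩ := exists_pos_eq_Ico w.2 s
    have hlt : s < min u₁ u₂ := lt_min h1 h2
    set u := min u₁ u₂ with hu
    have hkey : ∀ v, s ≤ v → v < u → w.1.pos v = w.2.pos v := fun v hv hv' => by
      rw [h1' v hv (hv'.trans_le (min_le_left _ _)), h2' v hv (hv'.trans_le (min_le_right _ _)), he]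
    rcases eq_or_ne t 0 with rfl | ht
    · obtain rfl : s = 0 := le_antisymm hs bot_le
      exact h 0 0 (by simp) (by simpa using he)
    · have ht0 : 0 < t := pos_iff_ne_zero.2 ht
      obtain ⟨m, hm⟩ : ∃ m : ℕ, t / (u - s) < 2 ^ m := pow_unbounded_of_one_lt _ one_lt_two
      have hpow : (0 : ℝ≥0) < 2 ^ m := by positivity
      have hus : 0 < u - s := tsub_pos_of_lt hlt
      have hstep : t / 2 ^ m < u - s := by
        rw [div_lt_iff₀ hpow, mul_comm]
        rwa [div_lt_iff₀ hus] at hm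
      have hstep0 : 0 < t / 2 ^ m := by positivity
      set δ := t / 2 ^ m with hδ
      refine h m ⌈s / δ⌉₊ ?_ (hkey _ ?_ ?_)
      · refine Nat.ceil_le.2 ?_
        rw [div_le_iff₀ hstep0, hδ]
        push_cast
        rwa [mul_div_cancel₀ _ hpow.ne']
      · rw [← div_le_iff₀ hstep0]
        exact Nat.le_ceil _
      · have : (⌈s / δ⌉₊ : ℝ≥0) < s / δ + 1 := Nat.ceil_lt_add_one bot_le
        calc (⌈s / δ⌉₊ : ℝ≥0) * δ < (s / δ + 1) * δ := by gcongr
          _ = s + δ := by rw [add_mul, div_mul_cancel₀ _ hstep0.ne', one_mul]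
          _ < s + (u - s) := by gcongr
          _ = u := add_tsub_cancel_of_le hlt.le

/-- The event that two walks are apart at the points `i t / 2 ^ m`, `i ≤ 2 ^ m`. -/
def gridApart (V : Type*) (t : ℝ≥0) (m : ℕ) : Set (Path V × Path V) :=
  {w | ∀ i : ℕ, i ≤ 2 ^ m → (pairPos w (i * (t / 2 ^ m))).1 ≠ (pairPos w (i * (t / 2 ^ m))).2}

theorem setOf_lt_meetTime (t : ℝ≥0) : {w : Path V × Path V | (t : ℝ≥0∞) < meetTime w} =
    ⋂ m : ℕ, gridApart V t m := by
  ext w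
  simp only [Set.mem_ofPred_eq, Set.mem_iInter, lt_meetTime_iff_dyadic, pairPos, gridApart]

theorem antitone_gridApart (t : ℝ≥0) : Antitone (gridApart V t) := by
  refine antitone_nat_of_succ_le fun m w hw i hi => ?_
  have h := hw (2 * i) (by rw [pow_succ]; omega)
  have e : ((2 * i : ℕ) : ℝ≥0) * (t / 2 ^ (m + 1)) = i * (t / 2 ^ m) := by
    push_cast
    field_simp
    ring
  rwa [e] at h

theorem measurableSet_gridApart [Finite V] (t : ℝ≥0) (m : ℕ) : MeasurableSet (gridApart V t m) := by
  simp only [gridApart, Set.ofPred_forall]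
  exact MeasurableSet.iInter fun i => MeasurableSet.iInter fun _ =>
    measurableSet_pairPos_mem _ fun z => z.1 ≠ z.2

theorem measurableSet_lt_meetTime [Finite V] (t : ℝ≥0) :
    MeasurableSet {w : Path V × Path V | (t : ℝ≥0∞) < meetTime w} := by
  rw [setOf_lt_meetTime]
  exact MeasurableSet.iInter fun m => measurableSet_gridApart t m

theorem measurable_meetTime [Finite V] : Measurable (meetTime : Path V × Path V → ℝ≥0∞) := by
  refine measurable_of_Ioi fun a => ?_
  induction a with
  | top => simp
  | coe t => exact measurableSet_lt_meetTime t

variable [Fintype V] [DecidableEq V] {r : V → V → ℝ} {P : V → Measure (Path V)}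

theorem ae_pos_zero {x : V} {μ : Measure (Path V)} (h : IsWalkLaw r x μ) :
    ∀ᵐ w ∂μ, w.pos 0 = x := by
  have := h.isProb
  refine (mem_ae_iff_prob_eq_one (measurableSet_pos_eq 0 x)).2 ?_
  have := h.fdd 0 (fun _ => 0) (fun _ => x) monotone_const rfl rfl
  simpa using this

theorem fdd_pair (hr : IsSymmIrredRates r) {x y : V} {μ ν : Measure (Path V)}
    (hμ : IsWalkLaw r x μ) (hν : IsWalkLaw r y ν) (s : ℝ≥0) (k : ℕ) (z : ℕ → V × V)
    (hz : z 0 = (x, y)) :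
    (μ.prod ν).real {w | ∀ i ≤ k, pairPos w (i * s) = z i} =
      ∏ i ∈ Finset.range k, (transition r s ⊗ₖ transition r s) (z i) (z (i + 1)) := by
  have := hμ.isProb
  have := hν.isProb
  have hset : {w : Path V × Path V | ∀ i ≤ k, pairPos w (i * s) = z i} =
      {w | ∀ i ≤ k, w.pos (i * s) = (z i).1} ×ˢ {w | ∀ i ≤ k, w.pos (i * s) = (z i).2} := by
    ext w
    simp only [pairPos, Prod.ext_iff, Set.mem_ofPred_eq, Set.mem_prod]
    exact ⟨fun h => ⟨fun i hi => (h i hi).1, fun i hi => (h i hi).2⟩,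
      fun h i hi => ⟨h.1 i hi, h.2 i hi⟩⟩
  have hmono : Monotone fun i : ℕ => (i : ℝ≥0) * s := fun i j hij => by
    simp only
    gcongr
  have h1 : ∀ (x : V) (μ : Measure (Path V)) (y : ℕ → V), IsWalkLaw r x μ → y 0 = x →
      μ.real {w | ∀ i ≤ k, w.pos (i * s) = y i} =
        ∏ i ∈ Finset.range k, transition r s (y i) (y (i + 1)) := by
    intro x μ y h hy
    rw [measureReal_def, h.fdd k (fun i => i * s) y hmono (by simp) hy, ENNReal.toReal_ofReal]
    · refine Finset.prod_congr rfl fun i _ => ?_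
      congr 1
      push_cast
      ring
    · refine Finset.prod_nonneg fun i _ => transition_nonneg hr ?_ _ _
      push_cast
      have : (0 : ℝ) ≤ s := s.2
      nlinarith
  rw [hset, measureReal_prod_prod, h1 x μ (fun i => (z i).1) hμ (by simp [hz]),
    h1 y ν (fun i => (z i).2) hν (by simp [hz]), ← Finset.prod_mul_distrib]
  simp [kroneckerMap_apply]

/-- The survival probability of two walks is given by the killed semigroup: on a dyadic grid it is
a power of the transition matrix restricted to the off-diagonal pairs, and the product formula
applies as the grid is refined. -/
theorem prod_real_lt_meetTime (hr : IsTransitiveChain r) (hP : ∀ x, IsWalkLaw r x (P x))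
    (t : ℝ≥0) (w : OffDiag V) :
    ((P w.1.1).prod (P w.1.2)).real {p | (t : ℝ≥0∞) < meetTime p} = survival r t w := by
  have hs := hr.toIsSymmIrredRates
  have := (hP w.1.1).isProb
  have := (hP w.1.2).isProb
  set μ := (P w.1.1).prod (P w.1.2) with hμ
  let B : ℝ → Matrix (OffDiag V) (OffDiag V) ℝ := fun s =>
    (transition r s ⊗ₖ transition r s).submatrix Subtype.val Subtype.val
  have hB0 : B 0 = 1 := by
    simp only [B, transition_zero, one_kronecker_one]
    exact submatrix_one _ Subtype.val_injective
  have hBd : ∀ i j, HasDerivAt (fun s => B s i j) (killedGen r i j) 0 := by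
    intro i j
    have h1 := hasDerivAt_exp_smul_zero (generator r) i.1.1 j.1.1
    have h2 := hasDerivAt_exp_smul_zero (generator r) i.1.2 j.1.2
    have h := h1.mul h2
    simp only [zero_smul, NormedSpace.exp_zero, Matrix.one_apply] at h
    simp only [killedGen, submatrix_apply, pairGen_apply]
    exact h
  have hne : Nonempty (OffDiag V) := ⟨w⟩
  have hlim := (tendsto_matrix_pow_exp hBd hB0 t).comp
    (tendsto_pow_atTop_atTop_of_one_lt (one_lt_two (α := ℕ)))
  have hae : ∀ᵐ p ∂μ, pairPos p 0 = w.1 := by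
    have h1 := (Measure.quasiMeasurePreserving_fst (μ := P w.1.1) (ν := P w.1.2)).ae
      (ae_pos_zero (hP w.1.1))
    have h2 := (Measure.quasiMeasurePreserving_snd (μ := P w.1.1) (ν := P w.1.2)).ae
      (ae_pos_zero (hP w.1.2))
    filter_upwards [h1, h2] with p hp1 hp2
    exact Prod.ext hp1 hp2
  have hgrid : ∀ m : ℕ, μ.real (gridApart V t m) =
        (B ((t : ℝ) / (2 ^ m : ℕ)) ^ 2 ^ m *ᵥ 1) w := by
    intro m
    have h := measureReal_stay (μ := μ) (Z := fun i p => pairPos p (i * (t / 2 ^ m)))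
      (D := fun z : V × V => z.1 ≠ z.2) (z₀ := w.1)
      (M := transition r (t / 2 ^ m : ℝ≥0) ⊗ₖ transition r (t / 2 ^ m : ℝ≥0))
      (fun i z => measurableSet_pairPos_eq _ z)
      (fun i => measurableSet_pairPos_mem _ fun z => z.1 ≠ z.2)
      (fun k z hz => fdd_pair hs (hP w.1.1) (hP w.1.2) _ k z hz)
      (by filter_upwards [hae] with p hp; simpa using hp) w.2 (2 ^ m)
    rw [gridApart, h]
    simp [B]
  have h1 : Tendsto (fun m : ℕ => μ.real (gridApart V t m)) atTop
      (𝓝 (survival r t w)) := by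
    simp_rw [hgrid]
    have hc : Continuous fun A : Matrix (OffDiag V) (OffDiag V) ℝ => (A *ᵥ 1) w :=
      (continuous_apply w).comp (continuous_id.matrix_mulVec continuous_const)
    exact (hc.tendsto _).comp hlim
  refine tendsto_nhds_unique ?_ h1
  rw [setOf_lt_meetTime]
  have h2 := tendsto_measure_iInter_atTop (μ := μ)
    (fun m => (measurableSet_gridApart t m).nullMeasurableSet) (antitone_gridApart t)
    ⟨0, measure_ne_top _ _⟩
  exact (ENNReal.tendsto_toReal (measure_ne_top _ _)).comp h2

theorem prod_real_lt_meetTime_diag (hP : ∀ x, IsWalkLaw r x (P x)) (t : ℝ≥0) (x : V) :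
    ((P x).prod (P x)).real {p | (t : ℝ≥0∞) < meetTime p} = 0 := by
  have := (hP x).isProb
  rw [measureReal_def, ENNReal.toReal_eq_zero_iff]
  left
  have h1 := (Measure.quasiMeasurePreserving_fst (μ := P x) (ν := P x)).ae (ae_pos_zero (hP x))
  have h2 := (Measure.quasiMeasurePreserving_snd (μ := P x) (ν := P x)).ae (ae_pos_zero (hP x))
  have h : ∀ᵐ p ∂((P x).prod (P x)), ¬ (t : ℝ≥0∞) < meetTime p := by
    filter_upwards [h1, h2] with p hp1 hp2
    rw [lt_meetTime_iff]
    intro h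
    exact h 0 bot_le (hp1.trans hp2.symm)
  simpa [ae_iff] using h

theorem pairLaw_apply (hP : ∀ x, IsWalkLaw r x (P x)) {μ ν : V → ℝ} (hμ : ∀ x, 0 ≤ μ x)
    (hν : ∀ x, 0 ≤ ν x) {S : Set (Path V × Path V)} (hS : MeasurableSet S) :
    pairLaw P μ ν S = ENNReal.ofReal (∑ x, ∑ y, μ x * ν y * ((P x).prod (P y)).real S) := by
  have := fun x => (hP x).isProb
  have hfin : IsFiniteMeasure (startLaw P ν) := by
    refine ⟨?_⟩
    simp [startLaw, ENNReal.ofReal_lt_top]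
  rw [pairLaw, Measure.prod_apply hS, startLaw, lintegral_finsetSum_measure,
    ENNReal.ofReal_sum_of_nonneg
      (fun x _ => Finset.sum_nonneg fun y _ => by have := hμ x; have := hν y; positivity)]
  refine Finset.sum_congr rfl fun x _ => ?_
  rw [lintegral_smul_measure, ENNReal.ofReal_sum_of_nonneg
    (fun y _ => by have := hμ x; have := hν y; positivity)]
  simp only [startLaw, Measure.finsetSum_apply, Measure.smul_apply, smul_eq_mul]
  rw [lintegral_finsetSum _ (fun y _ => (measurable_measure_prodMk_left hS).const_mul _),
    Finset.mul_sum]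
  refine Finset.sum_congr rfl fun y _ => ?_
  rw [lintegral_const_mul _ (measurable_measure_prodMk_left hS), ← Measure.prod_apply hS,
    mul_assoc, ENNReal.ofReal_mul (hμ x), ENNReal.ofReal_mul (hν y), ofReal_measureReal]

/-- Averages of survival probabilities only involve pairs off the diagonal. -/
theorem pairLaw_lt_meetTime (hr : IsTransitiveChain r) (hP : ∀ x, IsWalkLaw r x (P x))
    (t : ℝ≥0) {μ ν : V → ℝ} (hμ : ∀ x, 0 ≤ μ x) (hν : ∀ x, 0 ≤ ν x) :
    pairLaw P μ ν {p | (t : ℝ≥0∞) < meetTime p} =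
      ENNReal.ofReal (∑ w : OffDiag V, μ w.1.1 * ν w.1.2 * survival r t w) := by
  rw [pairLaw_apply hP hμ hν (measurableSet_lt_meetTime t)]
  congr 1
  rw [← Fintype.sum_prod_type' (f := fun x y => μ x * ν y *
    ((P x).prod (P y)).real {p | (t : ℝ≥0∞) < meetTime p}), sum_offDiag_of_diag_eq_zero]
  · refine Finset.sum_congr rfl fun w _ => ?_
    rw [prod_real_lt_meetTime hr hP]
  · intro a
    simp [prod_real_lt_meetTime_diag hP]

end Meeting

/-! ### Mixtures of exponential laws -/

section Mixture

variable {ι : Type*} [Fintype ι] {c l : ι → ℝ}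

theorem lintegral_of_exp_mixture {Ω : Type*} [MeasurableSpace Ω] {μ : Measure Ω} {f : Ω → ℝ≥0∞}
    (hf : Measurable f) (hc : ∀ i, 0 ≤ c i) (hl : ∀ i, 0 < l i)
    (h : ∀ t : ℝ≥0, μ {ω | (t : ℝ≥0∞) < f ω} =
      ENNReal.ofReal (∑ i, c i * Real.exp (-(l i * t)))) :
    ∫⁻ ω, f ω ∂μ = ENNReal.ofReal (∑ i, c i / l i) := by
  have hlim : Tendsto (fun t : ℝ => ∑ i, c i * Real.exp (-(l i * t))) atTop (𝓝 0) := by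
    rw [show (0 : ℝ) = ∑ i, c i * 0 by simp]
    refine tendsto_finsetSum _ fun i _ => Tendsto.const_mul _ ?_
    exact Real.tendsto_exp_neg_atTop_nhds_zero.comp (tendsto_id.const_mul_atTop (hl i))
  have htop : μ {ω | f ω = ⊤} = 0 := by
    have h1 := (ENNReal.continuous_ofReal.tendsto 0).comp hlim
    rw [ENNReal.ofReal_zero] at h1
    refine le_antisymm (ge_of_tendsto h1 ?_) bot_le
    filter_upwards [eventually_ge_atTop 0] with t ht
    have h2 := h ⟨t, ht⟩
    refine (measure_mono fun ω (hω : f ω = ⊤) => ?_).trans h2.le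
    rw [Set.mem_ofPred_eq, hω]
    exact ENNReal.coe_lt_top
  have hae : ∀ᵐ ω ∂μ, f ω ≠ ⊤ := by simpa [ae_iff] using htop
  have e1 : ∫⁻ ω, f ω ∂μ = ∫⁻ ω, ENNReal.ofReal (f ω).toReal ∂μ := by
    refine lintegral_congr_ae ?_
    filter_upwards [hae] with ω hω
    rw [ENNReal.ofReal_toReal hω]
  rw [e1, lintegral_eq_lintegral_meas_lt μ (Eventually.of_forall fun _ => ENNReal.toReal_nonneg)
    hf.ennreal_toReal.aemeasurable]
  have e2 : ∀ t ∈ Set.Ioi (0 : ℝ), μ {ω | t < (f ω).toReal} =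
      ENNReal.ofReal (∑ i, c i * Real.exp (-l i * t)) := by
    intro t ht
    lift t to ℝ≥0 using ht.le
    simp only [neg_mul]
    refine Eq.trans ?_ (h t)
    refine measure_congr ?_
    filter_upwards [hae] with ω hω
    refine propext ?_
    change (t : ℝ) < (f ω).toReal ↔ (t : ℝ≥0∞) < f ω
    rw [← ENNReal.ofReal_lt_iff_lt_toReal t.coe_nonneg hω, ENNReal.ofReal_coe_nnreal]
  have hint : ∀ i, IntegrableOn (fun t : ℝ => c i * Real.exp (-l i * t)) (Set.Ioi 0) := fun i =>
    (integrableOn_exp_mul_Ioi (neg_lt_zero.2 (hl i)) 0).const_mul (c i)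
  rw [setLIntegral_congr_fun measurableSet_Ioi e2, ← ofReal_integral_eq_lintegral_ofReal
    (integrable_finsetSum _ fun i _ => hint i)
    (Eventually.of_forall fun t => Finset.sum_nonneg fun i _ =>
      mul_nonneg (hc i) (Real.exp_pos _).le), integral_finsetSum _ fun i _ => hint i]
  congr 1
  refine Finset.sum_congr rfl fun i _ => ?_
  rw [integral_const_mul, integral_exp_mul_Ioi (neg_lt_zero.2 (hl i))]
  have := (hl i).ne'
  simp [div_eq_mul_inv]

/-- A mixture of exponential laws whose weights satisfy `1 - c i ≤ l i / g` is nearly exponential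
when `g` times its mean is large: its density at `t` times its mean is close to `1`. The weight of
the smallest rate carries almost all the mass, and the other terms are at most `c i / t`. -/
theorem mean_mul_density_bounds [Nonempty ι] {g t T : ℝ} (hc : ∀ i, 0 ≤ c i) (hl : ∀ i, 0 < l i)
    (hc1 : ∑ i, c i ≤ 1) (hg : 0 < g) (hgap : ∀ i, g * (1 - c i) ≤ l i) (ht : 0 < t)
    (hT : T = ∑ i, c i / l i) (hT0 : 0 < T) (htT : t ≤ T) (hgT : g⁻¹ ≤ T) :
    (1 - g⁻¹ / T) ^ 2 * (1 - t / T) ≤ T * ∑ i, c i * l i * Real.exp (-(l i * t)) ∧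
      T * ∑ i, c i * l i * Real.exp (-(l i * t)) ≤ 1 + g⁻¹ / t := by
  classical
  obtain ⟨j, -, hj⟩ := Finset.exists_min_image Finset.univ l Finset.univ_nonempty
  have hlj := hl j
  have hTl : T * l j ≤ 1 := by
    rw [hT, Finset.sum_mul]
    refine le_trans (Finset.sum_le_sum fun i _ => ?_) hc1
    rw [div_mul_eq_mul_div, div_le_iff₀ (hl i)]
    exact mul_le_mul_of_nonneg_left (hj i (Finset.mem_univ _)) (hc i)
  have hcT : c j ≤ T * l j := by
    rw [← div_le_iff₀ hlj, hT]
    exact Finset.single_le_sum (f := fun i => c i / l i)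
      (fun i _ => div_nonneg (hc i) (hl i).le) (Finset.mem_univ j)
  have hljT : l j ≤ 1 / T := by rw [le_div_iff₀ hT0, mul_comm]; exact hTl
  have hcj : 1 - c j ≤ g⁻¹ * l j := by
    rw [inv_mul_eq_div, le_div_iff₀ hg, mul_comm]; exact hgap j
  have hgi : 0 < g⁻¹ := inv_pos.2 hg
  have hε : 1 - g⁻¹ / T ≤ c j := by
    have : g⁻¹ * l j ≤ g⁻¹ * (1 / T) := mul_le_mul_of_nonneg_left hljT hgi.le
    rw [mul_one_div] at this
    linarith
  have hε0 : 0 ≤ 1 - g⁻¹ / T := by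
    have : g⁻¹ / T ≤ 1 := (div_le_one hT0).2 hgT
    linarith
  have hterm : ∀ i, 0 ≤ c i * l i * Real.exp (-(l i * t)) := fun i =>
    mul_nonneg (mul_nonneg (hc i) (hl i).le) (Real.exp_pos _).le
  have htT0 : 0 ≤ 1 - t / T := by
    have : t / T ≤ 1 := (div_le_one hT0).2 htT
    linarith
  constructor
  · have h1 : 1 - t / T ≤ Real.exp (-(l j * t)) := by
      have h2 := Real.add_one_le_exp (-(l j * t))
      have h3 : l j * t ≤ 1 / T * t := mul_le_mul_of_nonneg_right hljT ht.le
      rw [one_div_mul_eq_div] at h3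
      linarith
    calc (1 - g⁻¹ / T) ^ 2 * (1 - t / T)
        ≤ (c j * (T * l j)) * Real.exp (-(l j * t)) := by
          refine mul_le_mul ?_ h1 htT0 (mul_nonneg (hc j) (by positivity))
          rw [pow_two]
          exact mul_le_mul hε (hε.trans hcT) hε0 (hc j)
      _ = T * (c j * l j * Real.exp (-(l j * t))) := by ring
      _ ≤ _ := mul_le_mul_of_nonneg_left
          (Finset.single_le_sum (f := fun i => c i * l i * Real.exp (-(l i * t)))
            (fun i _ => hterm i) (Finset.mem_univ j)) hT0.le
  · have h1 : ∀ i, c i * l i * Real.exp (-(l i * t)) ≤ c i / t := by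
      intro i
      rw [mul_assoc, div_eq_mul_inv]
      refine mul_le_mul_of_nonneg_left ?_ (hc i)
      rw [Real.exp_neg, ← one_div t, le_div_iff₀ ht, mul_right_comm, ← div_eq_mul_inv,
        div_le_one (Real.exp_pos _)]
      linarith [Real.add_one_le_exp (l i * t)]
    have h2 : c j * l j * Real.exp (-(l j * t)) ≤ l j := by
      have hcj1 : c j ≤ 1 :=
        (Finset.single_le_sum (fun i _ => hc i) (Finset.mem_univ j)).trans hc1
      have he : Real.exp (-(l j * t)) ≤ 1 := Real.exp_le_one_iff.2 (by nlinarith)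
      calc c j * l j * Real.exp (-(l j * t)) ≤ 1 * l j * 1 := by
            refine mul_le_mul (mul_le_mul_of_nonneg_right hcj1 hlj.le) he (Real.exp_pos _).le ?_
            linarith
        _ = l j := by ring
    have h3 : ∑ i ∈ Finset.univ.erase j, c i * l i * Real.exp (-(l i * t)) ≤ (1 - c j) / t := by
      refine (Finset.sum_le_sum fun i _ => h1 i).trans ?_
      rw [← Finset.sum_div]
      refine div_le_div_of_nonneg_right ?_ ht.le
      rw [← Finset.add_sum_erase _ _ (Finset.mem_univ j)] at hc1
      linarith
    rw [← Finset.add_sum_erase _ _ (Finset.mem_univ j)]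
    calc _ ≤ T * (l j + g⁻¹ * l j / t) := by
          refine mul_le_mul_of_nonneg_left (add_le_add h2 (h3.trans ?_)) hT0.le
          exact div_le_div_of_nonneg_right hcj ht.le
      _ = (T * l j) * (1 + g⁻¹ / t) := by ring
      _ ≤ 1 * (1 + g⁻¹ / t) := mul_le_mul_of_nonneg_right hTl (by positivity)
      _ = _ := one_mul _

end Mixture

/-! ### The mean meeting time and `α_t` -/

section Mean

variable {V : Type*} [Fintype V] [DecidableEq V] {r : V → V → ℝ} {P : V → Measure (Path V)}

theorem alpha_eq (hr : IsTransitiveChain r) (hP : ∀ x, IsWalkLaw r x (P x)) (t : ℝ≥0) :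
    alpha r P t = (∑ w : OffDiag V, r w.1.1 w.1.2 * survival r t w) / Fintype.card V := by
  have hs := hr.toIsSymmIrredRates
  have hsurv : ∀ w, 0 ≤ survival r t w := fun w => by
    rw [← prod_real_lt_meetTime hr hP]; exact measureReal_nonneg
  have h : ∀ x, alphaAt r P t x =
      ∑ w : OffDiag V, pointMass x w.1.1 * r x w.1.2 * survival r t w := by
    intro x
    have hp : ∀ y, 0 ≤ pointMass x y := fun y => by unfold pointMass; split_ifs <;> norm_num
    have hj : ∀ y, jumpDist r x y = r x y := fun y => by
      rw [jumpDist, hr.totalRate_eq_one, div_one]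
    rw [alphaAt, hr.totalRate_eq_one, one_mul, measureReal_def, pairLaw_lt_meetTime hr hP t hp
      (fun y => by rw [hj]; exact hs.nonneg x y), ENNReal.toReal_ofReal]
    · simp_rw [hj]
    · exact Finset.sum_nonneg fun w _ => mul_nonneg (mul_nonneg (hp _)
        (by rw [hj]; exact hs.nonneg _ _)) (hsurv w)
  rw [alpha]
  congr 1
  simp_rw [h]
  rw [Finset.sum_comm]
  refine Finset.sum_congr rfl fun w _ => ?_
  simp [pointMass]

/-- The mean meeting time is finite and positive, and `2 t_meet α_t / |V|` is close to `1` when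
the relaxation time is small compared to `t`, and `t` is small compared to `t_meet`. -/
theorem meanMeetTime_mul_alpha_bounds [Nonempty V] (hr : IsTransitiveChain r)
    (hP : ∀ x, IsWalkLaw r x (P x)) :
    meanMeetTime P ≠ ⊤ ∧ 0 < (meanMeetTime P).toReal ∧ 0 < relaxTime r ∧
      ∀ t : ℝ≥0, 0 < t → (t : ℝ) ≤ (meanMeetTime P).toReal →
        relaxTime r ≤ (meanMeetTime P).toReal →
        (1 - relaxTime r / (meanMeetTime P).toReal) ^ 2 * (1 - t / (meanMeetTime P).toReal) ≤
          2 * (meanMeetTime P).toReal * alpha r P t / Fintype.card V ∧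
        2 * (meanMeetTime P).toReal * alpha r P t / Fintype.card V ≤ 1 + relaxTime r / t := by
  obtain ⟨c, l, hc, hl, hsum, hgap, hF, hα⟩ := exists_spectral hr
  have hn1 : (1 : ℝ) < Fintype.card V := by exact_mod_cast one_lt_card hr
  have hn : (0 : ℝ) < Fintype.card V := by linarith
  have hmean : meanMeetTime P = ENNReal.ofReal (∑ i, c i / l i) := by
    refine lintegral_of_exp_mixture measurable_meetTime hc hl fun t => ?_
    have hu : ∀ x : V, 0 ≤ unif V x := fun x => by unfold unif; positivity
    rw [pairLaw_lt_meetTime hr hP t hu hu, ← hF, Finset.sum_div]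
    congr 1
    refine Finset.sum_congr rfl fun w _ => ?_
    simp only [unif]
    field_simp
  have hne : Nonempty (OffDiag V) := by
    obtain ⟨x, y, hxy⟩ := Fintype.one_lt_card_iff.1 (one_lt_card hr)
    exact ⟨⟨(x, y), hxy⟩⟩
  have hsum0 : 0 < ∑ i, c i := by
    rw [hsum, sub_pos, div_lt_one hn]; exact hn1
  have hT0 : 0 < ∑ i, c i / l i := by
    obtain ⟨i, -, hi⟩ := Finset.exists_lt_of_sum_lt (s := Finset.univ) (f := fun _ => 0) (g := c)
      (by simpa using hsum0)
    exact (div_pos hi (hl i)).trans_le (Finset.single_le_sum (f := fun i => c i / l i)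
      (fun i _ => div_nonneg (hc i) (hl i).le) (Finset.mem_univ i))
  have hg := spectralGap_pos hr
  have hT : (meanMeetTime P).toReal = ∑ i, c i / l i := by
    rw [hmean, ENNReal.toReal_ofReal hT0.le]
  refine ⟨by rw [hmean]; exact ENNReal.ofReal_ne_top, hT ▸ hT0, inv_pos.2 hg,
    fun t ht htT hgT => ?_⟩
  have hc1 : ∑ i, c i ≤ 1 := by
    rw [hsum]
    have : 0 < 1 / (Fintype.card V : ℝ) := by positivity
    linarith
  have h := mean_mul_density_bounds (t := t) hc hl hc1 hg hgap (by exact_mod_cast ht) hT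
    (hT ▸ hT0) htT hgT
  have e : 2 * (meanMeetTime P).toReal * alpha r P t / Fintype.card V =
      (meanMeetTime P).toReal * ∑ i, c i * l i * Real.exp (-(l i * t)) := by
    rw [alpha_eq hr hP, hα]
    generalize ∑ i, c i * l i * Real.exp (-(l i * t)) = F
    field_simp
  rw [e]
  exact h

end Mean

end CRW

theorem proposition7p1
    {V : ℕ → Type*} [∀ n, Fintype (V n)] [∀ n, DecidableEq (V n)] [∀ n, Nonempty (V n)]
    (r : ∀ n, V n → V n → ℝ)
    (hr : ∀ n, CRW.IsTransitiveChain (r n))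
    (P : ∀ n, V n → Measure (CRW.Path (V n)))
    (hP : ∀ n x, CRW.IsWalkLaw (r n) x (P n x))
    (hrel : (fun n => CRW.relaxTime (r n)) =o[atTop]
      (fun n => (CRW.meanMeetTime (P n)).toReal))
    (t : ℕ → ℝ≥0)
    (hrel_t : (fun n => CRW.relaxTime (r n)) =o[atTop] (fun n => (t n : ℝ)))
    (ht_meet : (fun n => (t n : ℝ)) =o[atTop] (fun n => (CRW.meanMeetTime (P n)).toReal)) :
    (∀ n, CRW.meanMeetTime (P n) ≠ ⊤) ∧
    Tendsto (fun n => 2 * (CRW.meanMeetTime (P n)).toReal * CRW.alpha (r n) (P n) (t n) /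
      (Fintype.card (V n) : ℝ)) atTop (𝓝 1) ∧
    (Tendsto (fun n => (t n : ℝ) * CRW.alpha (r n) (P n) (t n) * CRW.density (r n) (t n))
        atTop (𝓝 1) ↔
      Tendsto (fun n => (Fintype.card (V n) : ℝ) * (t n : ℝ) /
        (2 * (CRW.meanMeetTime (P n)).toReal) * CRW.density (r n) (t n)) atTop (𝓝 1)) := by
  have key := fun n => CRW.meanMeetTime_mul_alpha_bounds (hr n) (hP n)
  have hT0 := fun n => (key n).2.1
  have hn : ∀ n, (0 : ℝ) < Fintype.card (V n) := fun n => by exact_mod_cast Fintype.card_pos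
  have hlim : Tendsto (fun n => 2 * (CRW.meanMeetTime (P n)).toReal *
      CRW.alpha (r n) (P n) (t n) / (Fintype.card (V n) : ℝ)) atTop (𝓝 1) := by
    have h1 := hrel.tendsto_div_nhds_zero
    have h2 := hrel_t.tendsto_div_nhds_zero
    have h3 := ht_meet.tendsto_div_nhds_zero
    have hlow := ((tendsto_const_nhds (x := (1 : ℝ))).sub h1 |>.pow 2).mul
      ((tendsto_const_nhds (x := (1 : ℝ))).sub h3)
    have hupp := (tendsto_const_nhds (x := (1 : ℝ))).add h2
    simp only [sub_zero, one_pow, mul_one, add_zero] at hlow hupp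
    have hev : ∀ᶠ n in atTop, 0 < t n ∧ (t n : ℝ) ≤ (CRW.meanMeetTime (P n)).toReal ∧
        CRW.relaxTime (r n) ≤ (CRW.meanMeetTime (P n)).toReal := by
      filter_upwards [hrel.def one_pos, hrel_t.def one_pos, ht_meet.def one_pos] with n a b c
      have hτ := (key n).2.2.1
      rw [one_mul, Real.norm_of_nonneg hτ.le, Real.norm_of_nonneg (hT0 n).le] at a
      rw [one_mul, Real.norm_of_nonneg hτ.le, Real.norm_of_nonneg (NNReal.coe_nonneg _)] at b
      rw [one_mul, Real.norm_of_nonneg (hT0 n).le, Real.norm_of_nonneg (NNReal.coe_nonneg _)] at c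
      exact ⟨by exact_mod_cast hτ.trans_le b, c, a⟩
    refine tendsto_of_tendsto_of_tendsto_of_le_of_le' hlow hupp ?_ ?_
    · filter_upwards [hev] with n h
      exact ((key n).2.2.2 (t n) h.1 h.2.1 h.2.2).1
    · filter_upwards [hev] with n h
      exact ((key n).2.2.2 (t n) h.1 h.2.1 h.2.2).2
  refine ⟨fun n => (key n).1, hlim, ?_⟩
  -- The two sequences differ by the factor `2 t_meet α_t / |V|`, which tends to `1`.
  have hfac : ∀ n, (t n : ℝ) * CRW.alpha (r n) (P n) (t n) * CRW.density (r n) (t n) =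
      (2 * (CRW.meanMeetTime (P n)).toReal * CRW.alpha (r n) (P n) (t n) /
        (Fintype.card (V n) : ℝ)) * ((Fintype.card (V n) : ℝ) * (t n : ℝ) /
        (2 * (CRW.meanMeetTime (P n)).toReal) * CRW.density (r n) (t n)) := by
    intro n
    have := (hT0 n).ne'
    have := (hn n).ne'
    field_simp
  constructor
  · intro h
    have h1 := h.div hlim one_ne_zero
    rw [div_one] at h1
    refine h1.congr' ?_
    filter_upwards [hlim.eventually_ne one_ne_zero] with n hq
    rw [Pi.div_apply, hfac n, mul_div_cancel_left₀ _ hq]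
  · intro h
    have h1 := hlim.mul h
    rw [one_mul] at h1
    exact h1.congr fun n => (hfac n).symm
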